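/- Let $E$ be a real Banach lattice, $X$ a real Banach space, and let $E'$ be the dual Banach lattice of $E$ (with $f\le g$ iff $f(x)\le g(x)$ for all $x\ge 0$). A bounded set $A\subset E$ is called *disjointly weakly compact* if every sequence $(x_n)$ in its solid hull $\{y\in E: |y|\le |a|\text{ for some }a\in A\}$ with $|x_m|\wedge|x_n|=0$ for all $m\neq n$ converges weakly to $0$. A bounded linear operator $T:E\to X$ is called *DW-compact* if $T(A)$ is relatively compact in norm for every disjointly weakly compact set $A\subset E$, and *weakly compact* if the image of the closed unit ball of $E$ is relatively weakly compact in $X$. Then the following assertions are equivalent. 1. Every DW-compact operator $T:E\to X$ is weakly compact. 2. The norm of $E'$ is order continuous (that is, $\|f_\alpha\|\to 0$ for every decreasing net $(f_\alpha)$ in $E'$ with infimum $0$), or $X$ is reflexive. -/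

import Mathlib

open Filter Topology

universe u v

namespace BanachLattice

/-- The canonical order on the topological dual of an ordered normed space:
`f ≤ g` iff `f x ≤ g x` for every `x` in the positive cone. It is an antisymmetric relation because
the positive cone of a vector lattice spans the space. -/
abbrev dualPartialOrder (E : Type u) [NormedAddCommGroup E] [Lattice E] [IsOrderedAddMonoid E]
    [NormedSpace ℝ E] : PartialOrder (StrongDual ℝ E) where
  le f g := ∀ x : E, 0 ≤ x → f x ≤ g x
  le_refl _ _ _ := le_rfl
  le_trans _ _ _ hfg hgh x hx := (hfg x hx).trans (hgh x hx)
  le_antisymm f g hfg hgf := by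
    have key : ∀ x : E, 0 ≤ x → f x = g x := fun x hx => le_antisymm (hfg x hx) (hgf x hx)
    ext x
    rw [← posPart_sub_negPart x, map_sub, map_sub, key _ (posPart_nonneg x),
      key _ (negPart_nonneg x)]

/-- The norm of an ordered normed space `F` is order continuous: every net `x_α ↓ 0` (decreasing,
with infimum `0`) converges to `0` in norm. Index sets in the universe of `F` are enough, since
the range of a decreasing net, ordered by `≥`, is itself the index set of such a net. -/
def HasOrderContinuousNorm (F : Type u) [NormedAddCommGroup F] [PartialOrder F] : Prop :=
  ∀ (ι : Type u) [Preorder ι] [IsDirectedOrder ι] [Nonempty ι] (x : ι → F),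
    Antitone x → IsGLB (Set.range x) 0 → Tendsto (fun i => ‖x i‖) atTop (𝓝 0)

/-- The norm of the dual Banach lattice `E'` is order continuous. -/
def DualHasOrderContinuousNorm (E : Type u) [NormedAddCommGroup E] [Lattice E]
    [IsOrderedAddMonoid E] [NormedSpace ℝ E] : Prop :=
  letI : PartialOrder (StrongDual ℝ E) := dualPartialOrder E
  HasOrderContinuousNorm (StrongDual ℝ E)

/-- A sequence of pairwise disjoint elements of a vector lattice: `|x m| ⊓ |x n| = 0` for
`m ≠ n`. -/
def IsDisjointSeq {E : Type u} [Lattice E] [AddCommGroup E] (x : ℕ → E) : Prop :=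
  ∀ m n : ℕ, m ≠ n → |x m| ⊓ |x n| = 0

/-- A bounded set `A` in a Banach lattice is disjointly weakly compact if every disjoint sequence
from its solid hull `{y | ∃ a ∈ A, |y| ≤ |a|}` converges weakly to `0`. -/
def IsDisjointlyWeaklyCompact {E : Type u} [NormedAddCommGroup E] [Lattice E] [NormedSpace ℝ E]
    (A : Set E) : Prop :=
  Bornology.IsBounded A ∧
    ∀ x : ℕ → E, IsDisjointSeq x → (∀ n, x n ∈ LatticeOrderedAddCommGroup.solidClosure A) →
      ∀ f : StrongDual ℝ E, Tendsto (fun n => f (x n)) atTop (𝓝 0)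

/-- A bounded operator from a Banach lattice into a Banach space is DW-compact if it maps
disjointly weakly compact sets onto relatively compact sets. -/
def IsDWCompact {E : Type u} {X : Type v} [NormedAddCommGroup E] [Lattice E] [NormedSpace ℝ E]
    [NormedAddCommGroup X] [NormedSpace ℝ X] (T : E →L[ℝ] X) : Prop :=
  ∀ A : Set E, IsDisjointlyWeaklyCompact A → IsCompact (closure (T '' A))

/-- A bounded operator is weakly compact if it maps the closed unit ball onto a relatively weakly
compact set. -/
def IsWeaklyCompactOperator {E : Type u} {X : Type v} [NormedAddCommGroup E] [NormedSpace ℝ E]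
    [NormedAddCommGroup X] [NormedSpace ℝ X] (T : E →L[ℝ] X) : Prop :=
  IsCompact (closure (toWeakSpace ℝ X '' (T '' Metric.closedBall (0 : E) 1)))

/-- A normed space is reflexive if the canonical embedding into its bidual is onto. -/
def IsReflexiveSpace (X : Type v) [NormedAddCommGroup X] [NormedSpace ℝ X] : Prop :=
  Function.Surjective (NormedSpace.inclusionInDoubleDual ℝ X)

end BanachLattice

/-! Order continuity of the norm of `E'` amounts to a property of `E`: positive functionals tend to
zero along bounded disjoint positive sequences (`tendsto_of_dualHasOrderContinuousNorm`,
`dualHasOrderContinuousNorm_of_forall_tendsto`). The unit ball of `E` is then itself disjointly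
weakly compact, so every DW-compact operator is compact. If `X` is reflexive, every bounded operator
is weakly compact.

If both conditions fail, there are a positive `f` and disjoint positive `z n` in the unit ball with
`f (z n) ≥ ε`, and, as in James's criterion, a bounded sequence `y n` in `X` that no relatively
weakly compact set contains, even after scaling (`exists_triangular_seq`,
`not_isCompact_closure_of_triangular`). The components `φ n` of `f` on the bands generated by the `z
n` have partial sums at most `f`, so `T x = ∑ φ n x • y n` converges absolutely. Multiples of the `z
n` inside the unit ball go to `ε • y n`, hence `T` is not weakly compact. It is DW-compact because
the tails of `∑ φ n |a|` are uniformly small on a disjointly weakly compact set (`exists_tail_le`):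
otherwise disjoint blocks in the solid hull would keep `f` away from zero. On such a set `T` is thus
a uniform limit of finite-rank operators. -/

namespace BanachLattice

/-! ### Disjointness in lattice-ordered groups. -/

section Lattice

variable {E : Type*} [AddCommGroup E] [Lattice E] [IsOrderedAddMonoid E]

/-- By distributivity of addition over `⊓`, the right side is the infimum of the four sums `x + y`,
`z + y`, `x + z`, `z + z`, each of which dominates the left side. -/
lemma add_inf_le_inf_add_inf {x y z : E} (hx : 0 ≤ x) (hy : 0 ≤ y) (hz : 0 ≤ z) :
    (x + y) ⊓ z ≤ x ⊓ z + y ⊓ z := by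
  rw [inf_add, add_inf, add_inf]
  refine le_inf (le_inf inf_le_left ?_) (le_inf ?_ ?_)
  · exact inf_le_right.trans (le_add_of_nonneg_left hx)
  · exact inf_le_right.trans (le_add_of_nonneg_right hy)
  · exact inf_le_right.trans (le_add_of_nonneg_right hz)

lemma nsmul_inf_eq_zero {x y : E} (hx : 0 ≤ x) (hy : 0 ≤ y) (h : x ⊓ y = 0) (n : ℕ) :
    (n • x) ⊓ y = 0 := by
  induction n with
  | zero => simpa using hy
  | succ n ih =>
    refine le_antisymm ?_ (le_inf (nsmul_nonneg hx _) hy)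
    rw [succ_nsmul]
    exact (add_inf_le_inf_add_inf (nsmul_nonneg hx n) hx hy).trans (by rw [ih, h, add_zero])

omit [IsOrderedAddMonoid E] in
lemma inf_eq_zero_of_le {x y x' y' : E} (hx : 0 ≤ x) (hy : 0 ≤ y) (hxx : x ≤ x') (hyy : y ≤ y')
    (h : x' ⊓ y' = 0) : x ⊓ y = 0 :=
  le_antisymm (h ▸ inf_le_inf hxx hyy) (le_inf hx hy)

lemma sum_inf_eq_zero {ι : Type*} {s : Finset ι} {a : ι → E} {y : E} (ha : ∀ i ∈ s, 0 ≤ a i)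
    (hy : 0 ≤ y) (h : ∀ i ∈ s, a i ⊓ y = 0) : (∑ i ∈ s, a i) ⊓ y = 0 := by
  classical
  induction s using Finset.induction_on with
  | empty => simpa using hy
  | insert i s hi ih =>
    rw [Finset.sum_insert hi]
    have hs : 0 ≤ ∑ j ∈ s, a j :=
      Finset.sum_nonneg fun j hj => ha j (Finset.mem_insert_of_mem hj)
    have hai := ha i (Finset.mem_insert_self i s)
    refine le_antisymm ?_ (le_inf (add_nonneg hai hs) hy)
    refine (add_inf_le_inf_add_inf hai hs hy).trans ?_
    rw [h i (Finset.mem_insert_self i s), zero_add]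
    exact (ih (fun j hj => ha j (Finset.mem_insert_of_mem hj))
      (fun j hj => h j (Finset.mem_insert_of_mem hj))).le

/-- Disjoint elements satisfy `a + b = a ⊔ b`, so a sum of disjoint elements is as small as their
supremum. -/
lemma sum_le_of_disjoint {ι : Type*} {s : Finset ι} {a : ι → E} {x : E} (ha : ∀ i, 0 ≤ a i)
    (hx : 0 ≤ x) (hax : ∀ i, a i ≤ x) (h : ∀ i j, i ≠ j → a i ⊓ a j = 0) :
    ∑ i ∈ s, a i ≤ x := by
  classical
  induction s using Finset.induction_on with
  | empty => simpa using hx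
  | insert i s hi ih =>
    rw [Finset.sum_insert hi, add_comm]
    have hd : (∑ j ∈ s, a j) ⊓ a i = 0 :=
      sum_inf_eq_zero (fun j _ => ha j) (ha i) fun j hj => h j i fun e => hi (e ▸ hj)
    rw [← inf_add_sup, hd, zero_add]
    exact sup_le ih (hax i)

lemma posPart_sub_inf_posPart_sub (x y : E) : (x - y)⁺ ⊓ (y - x)⁺ = 0 := by
  have := posPart_inf_negPart_eq_zero (x - y)
  rwa [← posPart_neg, neg_sub] at this

lemma posPart_sub_le {x y : E} (hx : 0 ≤ x) (hy : 0 ≤ y) : (x - y)⁺ ≤ x :=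
  sup_le (sub_le_self x hy) hx

end Lattice

/-! ### Positive functionals: extension from the cone, domination, band components. -/

section Functional

variable {E : Type*} [NormedAddCommGroup E] [Lattice E] [HasSolidNorm E] [IsOrderedAddMonoid E]
    [NormedSpace ℝ E]

omit [NormedSpace ℝ E] in
lemma norm_posPart_le (x : E) : ‖x⁺‖ ≤ ‖x‖ := by
  apply HasSolidNorm.solid
  rw [abs_of_nonneg (posPart_nonneg x), ← posPart_add_negPart x]
  exact le_add_of_nonneg_right (negPart_nonneg x)

omit [NormedSpace ℝ E] in
lemma norm_negPart_le (x : E) : ‖x⁻‖ ≤ ‖x‖ := by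
  simpa using norm_posPart_le (-x)

omit [NormedSpace ℝ E] in
lemma norm_le_norm_of_nonneg_of_le {x y : E} (hx : 0 ≤ x) (hxy : x ≤ y) : ‖x‖ ≤ ‖y‖ := by
  apply HasSolidNorm.solid
  rwa [abs_of_nonneg hx, abs_of_nonneg (hx.trans hxy)]

/-- A functional is positive if it is nonnegative on the positive cone. -/
def IsPositiveFunctional (f : StrongDual ℝ E) : Prop := ∀ x, 0 ≤ x → 0 ≤ f x

omit [HasSolidNorm E] in
lemma IsPositiveFunctional.mono {f : StrongDual ℝ E} (hf : IsPositiveFunctional f) {x y : E}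
    (h : x ≤ y) : f x ≤ f y := by
  have := hf (y - x) (sub_nonneg.2 h)
  rwa [map_sub, sub_nonneg] at this

omit [HasSolidNorm E] in
lemma IsPositiveFunctional.abs_apply_le {f : StrongDual ℝ E} (hf : IsPositiveFunctional f)
    (x : E) : |f x| ≤ f |x| :=
  abs_le'.2 ⟨hf.mono (le_abs_self x), by rw [← map_neg]; exact hf.mono (neg_le_abs x)⟩

lemma IsPositiveFunctional.norm_le {f : StrongDual ℝ E} (hf : IsPositiveFunctional f) {c : ℝ}
    (hc : 0 ≤ c) (h : ∀ x, 0 ≤ x → ‖x‖ ≤ 1 → f x ≤ c) : ‖f‖ ≤ c := by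
  refine f.opNorm_le_of_unit_norm hc fun x hx => ?_
  rw [Real.norm_eq_abs]
  exact (hf.abs_apply_le x).trans (h _ (abs_nonneg x) (by rw [norm_abs_eq_norm, hx]))

-- The identity `x + y = (x + y)⁺ - (x + y)⁻` freed of subtraction, so that a function additive only
-- on the cone can be applied to both sides.
omit [HasSolidNorm E] [NormedSpace ℝ E] in
lemma posPart_add_rearrange (x y : E) : (x + y)⁺ + (x⁻ + y⁻) = (x + y)⁻ + (x⁺ + y⁺) := by
  have h1 := posPart_sub_negPart (x + y)
  have h2 := posPart_sub_negPart x
  have h3 := posPart_sub_negPart y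
  rw [sub_eq_iff_eq_add] at h1 h2 h3
  rw [h1, h2, h3]
  abel

/-- An additive, bounded, nonnegative function on the cone extends to a continuous functional. -/
lemma exists_functional_of_additive (p : E → ℝ)
    (hadd : ∀ x y, 0 ≤ x → 0 ≤ y → p (x + y) = p x + p y) (hpos : ∀ x, 0 ≤ x → 0 ≤ p x)
    (C : ℝ) (hC : 0 ≤ C) (hb : ∀ x, 0 ≤ x → p x ≤ C * ‖x‖) :
    ∃ f : StrongDual ℝ E, ∀ x, 0 ≤ x → f x = p x := by
  have h0 : p 0 = 0 := by simpa using hadd 0 0 le_rfl le_rfl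
  let φ : E →+ ℝ :=
    { toFun := fun x => p x⁺ - p x⁻
      map_zero' := by simp
      map_add' := fun x y => by
        have h := congrArg p (posPart_add_rearrange x y)
        rw [hadd _ _ (posPart_nonneg _) (add_nonneg (negPart_nonneg _) (negPart_nonneg _)),
          hadd _ _ (negPart_nonneg _) (negPart_nonneg _),
          hadd _ _ (negPart_nonneg _) (add_nonneg (posPart_nonneg _) (posPart_nonneg _)),
          hadd _ _ (posPart_nonneg _) (posPart_nonneg _)] at h
        linarith }
  have hφ : Continuous φ := AddMonoidHomClass.continuous_of_bound φ C fun x => by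
    have h1 := hpos _ (posPart_nonneg x)
    have h2 := hpos _ (negPart_nonneg x)
    have h3 := (hb _ (posPart_nonneg x)).trans
      (mul_le_mul_of_nonneg_left (norm_posPart_le x) hC)
    have h4 := (hb _ (negPart_nonneg x)).trans
      (mul_le_mul_of_nonneg_left (norm_negPart_le x) hC)
    change |p x⁺ - p x⁻| ≤ _
    rw [abs_le]
    constructor <;> linarith
  -- Homogeneity comes for free: a continuous additive map between real spaces is linear.
  refine ⟨φ.toRealLinearMap hφ, fun x hx => ?_⟩
  change p x⁺ - p x⁻ = p x
  rw [posPart_of_nonneg hx, negPart_of_nonneg hx, h0, sub_zero]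

/-- Every functional is dominated, together with its opposite, by a positive one. -/
lemma exists_positive_dominating (f : StrongDual ℝ E) :
    ∃ g : StrongDual ℝ E, IsPositiveFunctional g ∧ ∀ x, |f x| ≤ g |x| := by
  -- Riesz–Kantorovich: the supremum of `f` over `[0, x]` is the value of `f⁺` at `x`.
  let S : E → Set ℝ := fun x => f '' Set.Icc 0 x
  have hne : ∀ x, 0 ≤ x → (0 : ℝ) ∈ S x := fun x hx => ⟨0, ⟨le_rfl, hx⟩, map_zero f⟩
  have hbd : ∀ x, ∀ r ∈ S x, r ≤ ‖f‖ * ‖x‖ := by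
    rintro x _ ⟨y, ⟨hy0, hyx⟩, rfl⟩
    exact (le_abs_self _).trans ((f.le_opNorm y).trans
      (mul_le_mul_of_nonneg_left (norm_le_norm_of_nonneg_of_le hy0 hyx) (norm_nonneg _)))
  have hba : ∀ x, BddAbove (S x) := fun x => ⟨_, hbd x⟩
  obtain ⟨g, hg⟩ := exists_functional_of_additive (fun x => sSup (S x))
    (by
      intro x y hx hy
      apply le_antisymm
      · refine csSup_le ⟨0, hne _ (add_nonneg hx hy)⟩ ?_
        rintro _ ⟨z, ⟨hz0, hz⟩, rfl⟩
        -- Riesz decomposition of `z ∈ [0, x + y]` into a part in `[0, x]` and a part in `[0, y]`.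
        have e : z = z ⊓ x + (z - z ⊓ x) := by abel
        rw [e, map_add]
        refine add_le_add (le_csSup (hba x) ⟨_, ⟨le_inf hz0 hx, inf_le_right⟩, rfl⟩)
          (le_csSup (hba y) ⟨_, ⟨sub_nonneg.2 inf_le_left, ?_⟩, rfl⟩)
        rw [sub_le_iff_le_add, add_inf]
        exact le_inf (le_add_of_nonneg_left hy) (by rwa [add_comm])
      · rw [← le_sub_iff_add_le]
        refine csSup_le ⟨0, hne _ hx⟩ ?_
        rintro _ ⟨a, ⟨ha0, ha⟩, rfl⟩
        rw [le_sub_iff_add_le, ← le_sub_iff_add_le']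
        refine csSup_le ⟨0, hne _ hy⟩ ?_
        rintro _ ⟨b, ⟨hb0, hb⟩, rfl⟩
        rw [le_sub_iff_add_le', ← map_add]
        exact le_csSup (hba _) ⟨_, ⟨add_nonneg ha0 hb0, add_le_add ha hb⟩, rfl⟩)
    (fun x hx => le_csSup (hba x) (hne x hx)) ‖f‖ (norm_nonneg _)
    (fun x hx => csSup_le ⟨0, hne x hx⟩ (hbd x))
  have hg0 : IsPositiveFunctional g := fun x hx => by
    rw [hg x hx]; exact le_csSup (hba x) (hne x hx)
  have hfg : ∀ x, 0 ≤ x → f x ≤ g x := fun x hx => by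
    rw [hg x hx]; exact le_csSup (hba x) ⟨x, ⟨hx, le_rfl⟩, rfl⟩
  -- With `g = f⁺` this is `f⁺ + f⁻ = |f|`.
  refine ⟨g + (g - f), fun x hx => ?_, fun x => ?_⟩
  · have := hg0 x hx
    have := hfg x hx
    simp only [add_apply, sub_apply]
    linarith
  · have e1 : f x = f x⁺ - f x⁻ := by rw [← map_sub, posPart_sub_negPart]
    have h1 := hg0 _ (posPart_nonneg x)
    have h2 := hg0 _ (negPart_nonneg x)
    have h3 := hfg _ (posPart_nonneg x)
    have h4 := hfg _ (negPart_nonneg x)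
    rw [← posPart_add_negPart x]
    simp only [add_apply, sub_apply, map_add]
    rw [e1, abs_le]
    constructor <;> linarith

/-- The pointwise infimum on the cone of a decreasing net of positive functionals. -/
lemma exists_pointwise_inf {ι : Type*} [Preorder ι] [IsDirectedOrder ι] [Nonempty ι]
    (f : ι → StrongDual ℝ E) (hpos : ∀ i, IsPositiveFunctional (f i))
    (hanti : ∀ i j, i ≤ j → ∀ x, 0 ≤ x → f j x ≤ f i x) :
    ∃ g : StrongDual ℝ E, IsPositiveFunctional g ∧ (∀ i x, 0 ≤ x → g x ≤ f i x) ∧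
      ∀ x, 0 ≤ x → Tendsto (fun i => f i x) atTop (𝓝 (g x)) := by
  have hlim : ∀ x, 0 ≤ x → Tendsto (fun i => f i x) atTop (𝓝 (⨅ i, f i x)) := fun x hx =>
    tendsto_atTop_ciInf (fun i j hij => hanti i j hij x hx)
      ⟨0, by rintro _ ⟨i, rfl⟩; exact hpos i x hx⟩
  have hle : ∀ i x, 0 ≤ x → (⨅ i, f i x) ≤ f i x := fun i x hx =>
    ciInf_le ⟨0, by rintro _ ⟨i, rfl⟩; exact hpos i x hx⟩ i
  have h0 : ∀ x, 0 ≤ x → 0 ≤ (⨅ i, f i x) := fun x hx => le_ciInf fun i => hpos i x hx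
  obtain ⟨i₀⟩ := ‹Nonempty ι›
  obtain ⟨g, hg⟩ := exists_functional_of_additive (fun x => ⨅ i, f i x)
    (fun x y hx hy => tendsto_nhds_unique (hlim _ (add_nonneg hx hy))
      (by simpa only [map_add] using (hlim x hx).add (hlim y hy)))
    h0 ‖f i₀‖ (norm_nonneg _)
    (fun x hx => (hle i₀ x hx).trans ((le_abs_self _).trans ((f i₀).le_opNorm x)))
  refine ⟨g, fun x hx => hg x hx ▸ h0 x hx, fun i x hx => hg x hx ▸ hle i x hx, fun x hx => ?_⟩
  rw [hg x hx]
  exact hlim x hx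

/-- The component of a positive functional `f` on the band generated by `z`. -/
lemma exists_component {f : StrongDual ℝ E} (hf : IsPositiveFunctional f) {z : E} (hz : 0 ≤ z) :
    ∃ g : StrongDual ℝ E, IsPositiveFunctional g ∧
      ∀ x, 0 ≤ x → Tendsto (fun k : ℕ => f (x ⊓ k • z)) atTop (𝓝 (g x)) := by
  have hkz : ∀ k : ℕ, 0 ≤ k • z := fun k => nsmul_nonneg hz k
  have hmono : ∀ x, Monotone fun k : ℕ => f (x ⊓ k • z) := fun x k l hkl =>
    hf.mono (inf_le_inf le_rfl (nsmul_le_nsmul_left hz hkl))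
  have hba : ∀ x, BddAbove (Set.range fun k : ℕ => f (x ⊓ k • z)) := fun x =>
    ⟨f x, by rintro _ ⟨k, rfl⟩; exact hf.mono inf_le_left⟩
  have hlim : ∀ x, Tendsto (fun k : ℕ => f (x ⊓ k • z)) atTop (𝓝 (⨆ k : ℕ, f (x ⊓ k • z))) :=
    fun x => tendsto_atTop_ciSup (hmono x) (hba x)
  have hle : ∀ x (k : ℕ), f (x ⊓ k • z) ≤ ⨆ k : ℕ, f (x ⊓ k • z) := fun x k => le_ciSup (hba x) k
  have h0 : ∀ x, 0 ≤ x → 0 ≤ ⨆ k : ℕ, f (x ⊓ k • z) := fun x hx =>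
    (hf _ (le_inf hx (hkz 0))).trans (hle x 0)
  obtain ⟨g, hg⟩ := exists_functional_of_additive (fun x => ⨆ k : ℕ, f (x ⊓ k • z))
    (by
      intro x y hx hy
      apply le_antisymm
      · refine ciSup_le fun k => ?_
        refine (hf.mono (add_inf_le_inf_add_inf hx hy (hkz k))).trans ?_
        rw [map_add]
        exact add_le_add (hle x k) (hle y k)
      -- Superadditivity: `x ⊓ k • z + y ⊓ k • z ≤ (x + y) ⊓ (2k) • z`.
      · refine le_of_tendsto' ((hlim x).add (hlim y)) fun k => ?_
        rw [← map_add]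
        refine (hf.mono (le_inf (add_le_add inf_le_left inf_le_left) ?_)).trans
          (hle (x + y) (k + k))
        rw [add_nsmul]
        exact add_le_add inf_le_right inf_le_right)
    h0 ‖f‖ (norm_nonneg _)
    (fun x hx => ciSup_le fun k => (hf.mono inf_le_left).trans
      ((le_abs_self _).trans (f.le_opNorm x)))
  refine ⟨g, fun x hx => hg x hx ▸ h0 x hx, fun x hx => ?_⟩
  rw [hg x hx]
  exact hlim x

/-- The components of a positive functional along a disjoint sequence. -/
lemma exists_components {f : StrongDual ℝ E} (hf : IsPositiveFunctional f) {z : ℕ → E}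
    (hz : ∀ n, 0 ≤ z n) (hd : ∀ m n, m ≠ n → z m ⊓ z n = 0) :
    ∃ φ : ℕ → StrongDual ℝ E, (∀ n, IsPositiveFunctional (φ n)) ∧
      (∀ n x, 0 ≤ x → Tendsto (fun k : ℕ => f (x ⊓ k • z n)) atTop (𝓝 (φ n x))) ∧
      (∀ n, φ n (z n) = f (z n)) ∧ (∀ m n, m ≠ n → φ m (z n) = 0) ∧
      ∀ (s : Finset ℕ) x, 0 ≤ x → ∑ n ∈ s, φ n x ≤ f x := by
  choose φ hφ0 hφ using fun n => exists_component hf (hz n)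
  refine ⟨φ, hφ0, hφ, fun n => ?_, fun m n hmn => ?_, fun s x hx => ?_⟩
  · refine tendsto_nhds_unique (hφ n _ (hz n)) (tendsto_const_nhds.congr' ?_)
    filter_upwards [eventually_ge_atTop 1] with k hk
    rw [inf_of_le_left]
    simpa using nsmul_le_nsmul_left (hz n) hk
  · refine tendsto_nhds_unique (hφ m _ (hz n)) (tendsto_const_nhds.congr fun k => ?_)
    rw [inf_comm, nsmul_inf_eq_zero (hz m) (hz n) (hd m n hmn), map_zero]
  -- For fixed `k` the elements `x ⊓ k • z n` are disjoint and below `x`, so their sum is below `x`.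
  · refine le_of_tendsto' (tendsto_finsetSum s fun n _ => hφ n x hx) fun k => ?_
    rw [← map_sum]
    refine hf.mono (sum_le_of_disjoint (fun n => le_inf hx (nsmul_nonneg (hz n) k)) hx
      (fun n => inf_le_left) fun m n hmn => ?_)
    refine inf_eq_zero_of_le (le_inf hx (nsmul_nonneg (hz m) k))
      (le_inf hx (nsmul_nonneg (hz n) k)) inf_le_right inf_le_right ?_
    apply nsmul_inf_eq_zero (hz m) (nsmul_nonneg (hz n) k)
    rw [inf_comm]
    exact nsmul_inf_eq_zero (hz n) (hz m) (hd n m hmn.symm) k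

end Functional

/-! ### Order continuity of the dual norm through disjoint sequences. -/

section OrderContinuity

variable {E : Type u} [NormedAddCommGroup E] [Lattice E] [HasSolidNorm E] [IsOrderedAddMonoid E]
    [NormedSpace ℝ E]

/-- If the norm of the dual is order continuous, bounded disjoint positive sequences are weakly
null. -/
lemma tendsto_of_dualHasOrderContinuousNorm (hE : DualHasOrderContinuousNorm E)
    {f : StrongDual ℝ E} (hf : IsPositiveFunctional f) {z : ℕ → E} (hz : ∀ n, 0 ≤ z n)
    (hd : ∀ m n, m ≠ n → z m ⊓ z n = 0) {C : ℝ} (hC : ∀ n, ‖z n‖ ≤ C) :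
    Tendsto (fun n => f (z n)) atTop (𝓝 0) := by
  obtain ⟨φ, hφ0, -, hφz, -, hφs⟩ := exists_components hf hz hd
  -- The remainders decrease to some `h`, in norm by order continuity. Their consecutive differences
  -- `φ n` therefore tend to zero in norm, and `f (z n) = φ n (z n) ≤ ‖φ n‖ * C`.
  let g : ℕ → StrongDual ℝ E := fun n => f - ∑ i ∈ Finset.range n, φ i
  have hgapp : ∀ n x, g n x = f x - ∑ i ∈ Finset.range n, φ i x := fun n x => by
    simp [g, sub_apply, sum_apply]
  have hgpos : ∀ n, IsPositiveFunctional (g n) := fun n x hx => by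
    rw [hgapp, sub_nonneg]
    exact hφs _ x hx
  have hganti : ∀ m n, m ≤ n → ∀ x, 0 ≤ x → g n x ≤ g m x := fun m n hmn x hx => by
    rw [hgapp, hgapp]
    exact sub_le_sub_left (Finset.sum_le_sum_of_subset_of_nonneg (Finset.range_mono hmn)
      fun i _ _ => hφ0 i x hx) _
  obtain ⟨h, -, hle, hlim⟩ := exists_pointwise_inf g hgpos hganti
  have hnorm : Tendsto (fun i : ULift.{u} ℕ => ‖g i.down - h‖) atTop (𝓝 0) := by
    refine hE (ULift.{u} ℕ) (fun i => g i.down - h) ?_ ⟨?_, ?_⟩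
    · intro i j hij x hx
      exact sub_le_sub_right (hganti _ _ hij x hx) _
    · rintro _ ⟨i, rfl⟩ x hx
      exact sub_nonneg.2 (hle _ x hx)
    · intro k hk x hx
      have h1 : ∀ n, k x ≤ g n x - h x := fun n => hk ⟨⟨n⟩, rfl⟩ x hx
      have h2 := (hlim x hx).sub_const (h x)
      rw [sub_self] at h2
      exact ge_of_tendsto' h2 h1
  have hup : Tendsto (fun n : ℕ => (⟨n⟩ : ULift.{u} ℕ)) atTop atTop :=
    tendsto_atTop.2 fun b => (eventually_ge_atTop b.down).mono fun n hn => hn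
  have hN : Tendsto (fun n => ‖g n - h‖) atTop (𝓝 0) := hnorm.comp hup
  have hN2 : Tendsto (fun n => (‖g n - h‖ + ‖g (n + 1) - h‖) * C) atTop (𝓝 0) := by
    simpa using (hN.add (hN.comp (tendsto_add_atTop_nat 1))).mul_const C
  refine squeeze_zero (fun n => hf _ (hz n)) (fun n => ?_) hN2
  have e : φ n = (g n - h) - (g (n + 1) - h) := by
    simp only [g, Finset.sum_range_succ]
    abel
  rw [← hφz n]
  refine (le_abs_self _).trans (((φ n).le_opNorm (z n)).trans ?_)
  refine mul_le_mul ?_ (hC n) (norm_nonneg _) (add_nonneg (norm_nonneg _) (norm_nonneg _))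
  rw [e]
  exact norm_sub_le _ _

/-- If the norm of the dual is order continuous, bounded sets are disjointly weakly compact. -/
lemma isDisjointlyWeaklyCompact_closedBall (hE : DualHasOrderContinuousNorm E) :
    IsDisjointlyWeaklyCompact (Metric.closedBall (0 : E) 1) := by
  refine ⟨Metric.isBounded_closedBall, fun x hx hxA f => ?_⟩
  obtain ⟨g, hg, hfg⟩ := exists_positive_dominating f
  refine squeeze_zero_norm (fun n => hfg (x n))
    (tendsto_of_dualHasOrderContinuousNorm hE hg (fun n => abs_nonneg (x n)) hx (C := 1)
      fun n => ?_)
  obtain ⟨a, ha, hxa⟩ := hxA n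
  rw [norm_abs_eq_norm]
  exact (HasSolidNorm.solid hxa).trans (by simpa using ha)

variable [IsOrderedModule ℝ E] [CompleteSpace E]

/-- If a positive functional tends to zero along disjoint sequences of the positive part of the
unit ball, then it is small on the part of the unit ball above a suitable element. -/
lemma exists_posPart_sub_le {f : StrongDual ℝ E} (hf : IsPositiveFunctional f)
    (h : ∀ z : ℕ → E, (∀ n, 0 ≤ z n) → (∀ n, ‖z n‖ ≤ 1) → (∀ m n, m ≠ n → z m ⊓ z n = 0) →
      Tendsto (fun n => f (z n)) atTop (𝓝 0)) {ε : ℝ} (hε : 0 < ε) :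
    ∃ u : E, 0 ≤ u ∧ ∀ x, 0 ≤ x → ‖x‖ ≤ 1 → f (x - u)⁺ ≤ ε := by
  by_contra! hcon
  choose! G hG0 hG1 hGε using hcon
  -- `s n` is the sum of the earlier `x m`, and `x n` is a counterexample for `u = 4 ^ n • s n`.
  let s : ℕ → E := fun n => Nat.rec 0 (fun n s => s + G ((4 ^ n : ℕ) • s)) n
  let x : ℕ → E := fun n => G ((4 ^ n : ℕ) • s n)
  have hss : ∀ n, s (n + 1) = s n + x n := fun n => rfl
  have hs0 : ∀ n, 0 ≤ s n := by
    intro n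
    induction n with
    | zero => exact le_rfl
    | succ n ih => rw [hss]; exact add_nonneg ih (hG0 _ (nsmul_nonneg ih _))
  have hcs : ∀ n, 0 ≤ (4 ^ n : ℕ) • s n := fun n => nsmul_nonneg (hs0 n) _
  have hx0 : ∀ n, 0 ≤ x n := fun n => hG0 _ (hcs n)
  have hx1 : ∀ n, ‖x n‖ ≤ 1 := fun n => hG1 _ (hcs n)
  have hxε : ∀ n, ε < f (x n - (4 ^ n : ℕ) • s n)⁺ := fun n => hGε _ (hcs n)
  have hsm : Monotone s := monotone_nat_of_le_succ fun n => by
    rw [hss]; exact le_add_of_nonneg_right (hx0 n)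
  have hxs : ∀ m n, m < n → x m ≤ s n := fun m n hmn =>
    (le_add_of_nonneg_left (hs0 m)).trans ((hss m).symm.le.trans (hsm hmn))
  have hsum : Summable fun n => ((1 / 2 : ℝ) ^ n) • x n := by
    refine Summable.of_norm_bounded (summable_geometric_of_lt_one (by norm_num)
      (by norm_num : (1 / 2 : ℝ) < 1)) fun n => ?_
    rw [norm_smul, Real.norm_of_nonneg (by positivity)]
    exact mul_le_of_le_one_right (by positivity) (hx1 n)
  let w : E := ∑' n, ((1 / 2 : ℝ) ^ n) • x n
  have hterm : ∀ n, 0 ≤ ((1 / 2 : ℝ) ^ n) • x n := fun n =>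
    smul_nonneg (by positivity) (hx0 n)
  have hw0 : 0 ≤ w := tsum_nonneg hterm
  have hxw : ∀ n, ((1 / 2 : ℝ) ^ n) • x n ≤ w := fun n =>
    hsum.le_tsum n fun j _ => hterm j
  -- Subtracting `4 ^ n • s n` separates `x n` from the earlier terms; subtracting `2⁻ⁿ • w`
  -- separates it from the later ones, since `2⁻ᵏ • x k ≤ w`. The second correction costs only `2⁻ⁿ
  -- * f w`.
  let v : ℕ → E := fun n => (x n - (4 ^ n : ℕ) • s n - ((1 / 2 : ℝ) ^ n) • w)⁺
  have hpw : ∀ n, 0 ≤ ((1 / 2 : ℝ) ^ n) • w := fun n => smul_nonneg (by positivity) hw0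
  have hv0 : ∀ n, 0 ≤ v n := fun n => posPart_nonneg _
  have hvx : ∀ n, v n ≤ x n := fun n => by
    simp only [v, sub_sub]
    exact posPart_sub_le (hx0 n) (add_nonneg (hcs n) (hpw n))
  have hvd' : ∀ m n, m < n → v m ⊓ v n = 0 := by
    intro m n hmn
    -- With `c = 2 ^ (m + n)`, `v n` lies below `(x n - c • x m)⁺` and `c • v m` below `(c • x m - x
    -- n)⁺`, which are disjoint; `4 ^ n ≥ c` because `m < n`.
    have h1 : v n ≤ (x n - (2 ^ (m + n) : ℕ) • x m)⁺ := by
      refine posPart_mono ?_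
      rw [sub_sub]
      refine sub_le_sub_left (le_add_of_le_of_nonneg ?_ (hpw n)) _
      have h24 : 2 ^ (m + n) ≤ 4 ^ n := by
        rw [show (4 : ℕ) = 2 ^ 2 by norm_num, ← pow_mul]
        exact Nat.pow_le_pow_right (by norm_num) (by omega)
      exact (nsmul_le_nsmul_left (hx0 m) h24).trans (nsmul_le_nsmul_right (hxs m n hmn) _)
    have h2 : (2 ^ (m + n) : ℕ) • v m ≤ ((2 ^ (m + n) : ℕ) • x m - x n)⁺ := by
      have h3 : v m ≤ (x m - ((1 / 2 : ℝ) ^ (m + n)) • x n)⁺ := by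
        refine posPart_mono ?_
        rw [sub_sub]
        refine sub_le_sub_left (le_add_of_nonneg_of_le (hcs m) ?_) _
        rw [pow_add, mul_smul]
        exact smul_le_smul_of_nonneg_left (hxw n) (by positivity)
      have hc : (0 : ℝ) ≤ 2 ^ (m + n) := by positivity
      have h4 : (2 ^ (m + n) : ℕ) • v m = ((2 : ℝ) ^ (m + n)) • v m := by
        rw [← Nat.cast_smul_eq_nsmul ℝ]; norm_num
      have h5 : (2 ^ (m + n) : ℕ) • x m = ((2 : ℝ) ^ (m + n)) • x m := by
        rw [← Nat.cast_smul_eq_nsmul ℝ]; norm_num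
      rw [h4, h5]
      refine (smul_le_smul_of_nonneg_left h3 hc).trans ?_
      have hcp : (0 : ℝ) < 2 ^ (m + n) := by positivity
      have key : (x m - ((1 / 2 : ℝ) ^ (m + n)) • x n)⁺ ≤
          ((2 : ℝ) ^ (m + n))⁻¹ • ((2 : ℝ) ^ (m + n) • x m - x n)⁺ := by
        refine sup_le ?_ (smul_nonneg (by positivity) (posPart_nonneg _))
        calc x m - ((1 / 2 : ℝ) ^ (m + n)) • x n
            = ((2 : ℝ) ^ (m + n))⁻¹ • ((2 : ℝ) ^ (m + n) • x m - x n) := by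
              rw [smul_sub, smul_smul, inv_mul_cancel₀ hcp.ne', one_smul, one_div, inv_pow]
          _ ≤ _ := smul_le_smul_of_nonneg_left (le_posPart _) (by positivity)
      refine (smul_le_smul_of_nonneg_left key hc).trans ?_
      rw [smul_smul, mul_inv_cancel₀ hcp.ne', one_smul]
    refine inf_eq_zero_of_le (hv0 m) (hv0 n) ?_ h1
      (inf_eq_zero_of_le (nsmul_nonneg (hv0 m) _) (posPart_nonneg _) h2 le_rfl
        (posPart_sub_inf_posPart_sub _ _))
    simpa using nsmul_le_nsmul_left (hv0 m) (Nat.one_le_two_pow (n := m + n))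
  have hvd : ∀ m n, m ≠ n → v m ⊓ v n = 0 := fun m n hmn => by
    rcases lt_or_gt_of_ne hmn with hlt | hlt
    · exact hvd' m n hlt
    · rw [inf_comm]; exact hvd' n m hlt
  have hlim := h v hv0 (fun n => (norm_le_norm_of_nonneg_of_le (hv0 n) (hvx n)).trans (hx1 n)) hvd
  have hlim2 : Tendsto (fun n => f (v n) + (1 / 2 : ℝ) ^ n * f w) atTop (𝓝 0) := by
    simpa using hlim.add ((tendsto_pow_atTop_nhds_zero_of_lt_one (by norm_num)
      (by norm_num : (1 / 2 : ℝ) < 1)).mul_const (f w))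
  refine absurd (ge_of_tendsto' hlim2 fun n => ?_) (not_le.2 hε)
  refine (hxε n).le.trans ?_
  have hle : (x n - (4 ^ n : ℕ) • s n)⁺ ≤ v n + ((1 / 2 : ℝ) ^ n) • w := by
    refine sup_le ?_ (add_nonneg (hv0 n) (hpw n))
    rw [← sub_le_iff_le_add]
    exact le_posPart _
  simpa using hf.mono hle

/-- If bounded disjoint positive sequences are weakly null, the dual norm is order continuous. -/
lemma dualHasOrderContinuousNorm_of_forall_tendsto
    (h : ∀ f : StrongDual ℝ E, IsPositiveFunctional f → ∀ z : ℕ → E, (∀ n, 0 ≤ z n) →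
      (∀ n, ‖z n‖ ≤ 1) → (∀ m n, m ≠ n → z m ⊓ z n = 0) →
      Tendsto (fun n => f (z n)) atTop (𝓝 0)) : DualHasOrderContinuousNorm E := by
  intro ι _ _ _ φ hanti hglb
  have hpos : ∀ i, IsPositiveFunctional (φ i) := fun i x hx => hglb.1 ⟨i, rfl⟩ x hx
  have hmono : ∀ i j, i ≤ j → ∀ x, 0 ≤ x → φ j x ≤ φ i x := fun i j hij x hx => hanti hij x hx
  obtain ⟨g, hg, hle, hlim⟩ := exists_pointwise_inf φ hpos hmono
  have hg0 : ∀ x, 0 ≤ x → g x ≤ 0 := fun x hx =>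
    hglb.2 (by rintro _ ⟨i, rfl⟩ y hy; exact hle i y hy) x hx
  obtain ⟨i₀⟩ := ‹Nonempty ι›
  refine Metric.tendsto_nhds.2 fun ε hε => ?_
  -- One `u`, chosen for `φ i₀`, serves all later indices because the net decreases. In `x ≤ u + (x
  -- - u)⁺`, pointwise convergence at `u` handles the other summand.
  obtain ⟨u, hu0, hu⟩ := exists_posPart_sub_le (hpos i₀) (h _ (hpos i₀))
    (show (0 : ℝ) < ε / 3 by positivity)
  have hlu : Tendsto (fun i => φ i u) atTop (𝓝 0) := by
    have := hlim u hu0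
    rwa [le_antisymm (hg0 u hu0) (hg u hu0)] at this
  filter_upwards [hlu.eventually (ge_mem_nhds (show (0 : ℝ) < ε / 3 by positivity)),
    eventually_ge_atTop i₀] with i hi hii
  rw [Real.dist_eq, sub_zero, abs_of_nonneg (norm_nonneg _)]
  refine lt_of_le_of_lt ((hpos i).norm_le (c := ε / 3 + ε / 3) (by positivity)
    fun x hx hx1 => ?_) (by linarith)
  have hxu : x ≤ u + (x - u)⁺ := by
    rw [← sub_le_iff_le_add']; exact le_posPart _
  refine ((hpos i).mono hxu).trans ?_
  rw [map_add]
  exact add_le_add hi ((hmono _ _ hii _ (posPart_nonneg _)).trans (hu x hx hx1))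

end OrderContinuity

/-! ### Goldstine approximation, James-type sequences and weak compactness. -/

section Reflexivity

/-- **Goldstine's theorem**, for finitely many functionals. -/
lemma exists_norm_le_one_forall_abs_sub_lt {Z : Type*} [NormedAddCommGroup Z] [NormedSpace ℝ Z]
    (F : StrongDual ℝ (StrongDual ℝ Z)) (hF : ‖F‖ ≤ 1) (s : Finset (StrongDual ℝ Z))
    {ε : ℝ} (hε : 0 < ε) : ∃ z : Z, ‖z‖ ≤ 1 ∧ ∀ φ ∈ s, |φ z - F φ| < ε := by
  classical
  let L : Z →L[ℝ] (s → ℝ) := ContinuousLinearMap.pi fun φ => φ.1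
  let p : s → ℝ := fun φ => F φ.1
  have hconv : Convex ℝ (closure (L '' Metric.closedBall 0 1)) :=
    ((convex_closedBall (0 : Z) 1).linear_image L.toLinearMap).closure
  have hp : p ∈ closure (L '' Metric.closedBall 0 1) := by
    by_contra hp
    -- The separating functional on the finite product pulls back to a combination `ψ` of members of
    -- `s` with `‖ψ‖ ≤ c < F ψ`, against `‖F‖ ≤ 1`.
    obtain ⟨a, c, hac, hcp⟩ := geometric_hahn_banach_closed_point hconv isClosed_closure hp
    have ha : ∀ y : s → ℝ, a y = ∑ φ : s, y φ * a (Pi.single φ 1) := fun y => by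
      conv_lhs => rw [pi_eq_sum_univ' y]
      simp [map_sum]
    let ψ : StrongDual ℝ Z := ∑ φ : s, a (Pi.single φ 1) • φ.1
    have hψ : ∀ z, ψ z = a (L z) := fun z => by
      rw [ha]; simp [ψ, L, sum_apply, mul_comm]
    have hFψ : F ψ = a p := by
      rw [ha]; simp [ψ, p, mul_comm]
    have hlt : ∀ z, ‖z‖ ≤ 1 → ψ z ≤ c := fun z hz => by
      rw [hψ]
      exact (hac _ (subset_closure ⟨z, by simpa using hz, rfl⟩)).le
    have hc0 : 0 ≤ c := by simpa using hlt 0 (by simp)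
    have hnorm : ‖ψ‖ ≤ c := ψ.opNorm_le_of_unit_norm hc0 fun z hz => by
      rw [Real.norm_eq_abs, abs_le']
      exact ⟨hlt z hz.le, by simpa using hlt (-z) (by simp [hz])⟩
    have : F ψ ≤ c := (le_abs_self _).trans ((F.le_opNorm ψ).trans
      ((mul_le_of_le_one_left (norm_nonneg _) hF).trans hnorm))
    linarith
  obtain ⟨_, ⟨z, hz, rfl⟩, hzp⟩ := Metric.mem_closure_iff.1 hp ε hε
  refine ⟨z, by simpa using hz, fun φ hφ => ?_⟩
  have := (dist_le_pi_dist p (L z) ⟨φ, hφ⟩).trans_lt hzp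
  rwa [dist_comm, Real.dist_eq] at this

set_option maxSynthPendingDepth 5 in
/-- A functional of arbitrary norm is approximated by a multiple of the unit ball. -/
lemma exists_norm_le_forall_abs_sub_lt {Z : Type*} [NormedAddCommGroup Z] [NormedSpace ℝ Z]
    (F : StrongDual ℝ (StrongDual ℝ Z)) {C : ℝ} (hC : 0 < C) (hF : ‖F‖ ≤ C)
    (s : Finset (StrongDual ℝ Z)) {ε : ℝ} (hε : 0 < ε) :
    ∃ z : Z, ‖z‖ ≤ C ∧ ∀ φ ∈ s, |φ z - F φ| < ε := by
  obtain ⟨z, hz, h⟩ := exists_norm_le_one_forall_abs_sub_lt (C⁻¹ • F)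
    (by rw [norm_smul, Real.norm_of_nonneg (by positivity)]
        exact (inv_mul_le_one₀ hC).2 hF) s (show 0 < ε / C by positivity)
  refine ⟨C • z, ?_, fun φ hφ => ?_⟩
  · rw [norm_smul, Real.norm_of_nonneg hC.le]
    exact mul_le_of_le_one_right hC.le hz
  · have e : φ (C • z) - F φ = C * (φ z - (C⁻¹ • F) φ) := by
      simp only [map_smul, smul_eq_mul, smul_apply]
      field_simp
    rw [e, abs_mul, abs_of_pos hC, mul_comm, ← lt_div_iff₀ hC]
    exact h φ hφ

variable {X : Type v} [NormedAddCommGroup X] [NormedSpace ℝ X]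

set_option maxSynthPendingDepth 5 in
/-- An approximate form of James's criterion: a non-reflexive Banach space contains a bounded
sequence that is triangularly separated by a bounded sequence of functionals. -/
lemma exists_triangular_seq [CompleteSpace X] (hX : ¬ IsReflexiveSpace X) :
    ∃ (y : ℕ → X) (ψ : ℕ → StrongDual ℝ X) (C : ℝ), 0 < C ∧ (∃ R, ∀ n, ‖y n‖ ≤ R) ∧
      (∀ n, ‖ψ n‖ ≤ C) ∧ (∀ m n, m ≤ n → 1 / 2 ≤ ψ m (y n)) ∧
      ∀ m n, m < n → ψ n (y m) ≤ 1 / 4 := by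
  classical
  simp only [IsReflexiveSpace, Function.Surjective, not_forall] at hX
  obtain ⟨F, hF⟩ := hX
  let J := NormedSpace.inclusionInDoubleDual ℝ X
  have hcl : IsClosed (LinearMap.range J.toLinearMap : Set (StrongDual ℝ (StrongDual ℝ X))) := by
    have := (NormedSpace.inclusionInDoubleDualLi (E := X) ℝ).isometry
    exact this.antilipschitz.isClosed_range this.uniformContinuous
  obtain ⟨Φ, c, hΦ, hcF⟩ := geometric_hahn_banach_closed_point
    (LinearMap.range J.toLinearMap).convex hcl (x := F) (fun ⟨x, hx⟩ => hF ⟨x, hx⟩)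
  have hc : 0 < c := by simpa using hΦ 0 (zero_mem _)
  -- A functional bounded above on a subspace vanishes there; otherwise a scaling attains the bound
  -- `c`.
  have hΦ0 : ∀ x, Φ (J x) = 0 := by
    intro x
    by_contra hne
    have := hΦ (J (((c / Φ (J x)) : ℝ) • x)) ⟨_, rfl⟩
    rw [map_smul, map_smul, smul_eq_mul, div_mul_cancel₀ _ hne] at this
    exact lt_irrefl _ this
  have hΦF : 0 < Φ F := hc.trans hcF
  let Ψ := (Φ F)⁻¹ • Φ
  have hΨF : Ψ F = 1 := by simp [Ψ, hΦF.ne', smul_apply]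
  have hΨ0 : ∀ x, Ψ (J x) = 0 := fun x => by simp [Ψ, hΦ0, smul_apply]
  have hCpos : 0 < ‖Ψ‖ + 1 := by positivity
  have hRpos : 0 < ‖F‖ + 1 := by positivity
  -- Goldstine is used twice per step. Approximating `Ψ` gives `ψ` nearly zero on the earlier `y`
  -- with `F ψ` near 1; approximating `F` then gives `y` on which `ψ` and all earlier functionals
  -- nearly agree with their values under `F`. The invariant `3 / 4 ≤ F q.2` absorbs the error `1 /
  -- 4`.
  obtain ⟨q, hq, hqr⟩ := exists_seq_of_forall_finset_exists
    (fun q : X × StrongDual ℝ X => ‖q.1‖ ≤ ‖F‖ + 1 ∧ ‖q.2‖ ≤ ‖Ψ‖ + 1 ∧ 1 / 2 ≤ q.2 q.1 ∧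
      3 / 4 ≤ F q.2)
    (fun a b => 1 / 2 ≤ a.2 b.1 ∧ b.2 a.1 ≤ 1 / 4) (by
      intro s hs
      obtain ⟨ψ, hψ, hψs⟩ := exists_norm_le_forall_abs_sub_lt Ψ hCpos (by linarith)
        (insert F (s.image fun a => J a.1)) (show (0 : ℝ) < 1 / 4 by norm_num)
      have hFψ : 3 / 4 ≤ F ψ := by
        have := hψs F (Finset.mem_insert_self _ _)
        rw [hΨF, abs_lt] at this
        linarith [this.1]
      obtain ⟨y, hy, hys⟩ := exists_norm_le_forall_abs_sub_lt F hRpos (by linarith)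
        (insert ψ (s.image fun a => a.2)) (show (0 : ℝ) < 1 / 4 by norm_num)
      refine ⟨(y, ψ), ⟨hy, hψ, ?_, hFψ⟩, fun a ha => ⟨?_, ?_⟩⟩
      · have := hys ψ (Finset.mem_insert_self _ _)
        rw [abs_lt] at this
        linarith [this.1]
      · have := hys a.2 (Finset.mem_insert_of_mem (Finset.mem_image_of_mem _ ha))
        rw [abs_lt] at this
        linarith [this.1, (hs a ha).2.2.2]
      · have := hψs (J a.1) (Finset.mem_insert_of_mem
          (Finset.mem_image_of_mem (fun a : X × StrongDual ℝ X => J a.1) ha))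
        rw [hΨ0, sub_zero, abs_lt] at this
        exact this.2.le)
  refine ⟨fun n => (q n).1, fun n => (q n).2, ‖Ψ‖ + 1, hCpos, ⟨‖F‖ + 1, fun n => (hq n).1⟩,
    fun n => (hq n).2.1, fun m n hmn => ?_, fun m n hmn => (hqr m n hmn).2⟩
  rcases hmn.eq_or_lt with rfl | hlt
  · exact (hq m).2.2.1
  · exact (hqr m n hlt).1

/-- A triangularly separated sequence is not relatively weakly compact, nor are its multiples. -/
lemma not_isCompact_closure_of_triangular {y : ℕ → X} {ψ : ℕ → StrongDual ℝ X} {C : ℝ}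
    (hC : 0 < C) (hψ : ∀ n, ‖ψ n‖ ≤ C) (h1 : ∀ m n, m ≤ n → 1 / 2 ≤ ψ m (y n))
    (h2 : ∀ m n, m < n → ψ n (y m) ≤ 1 / 4) {c : ℝ} (hc : 0 < c) {S : Set X}
    (hS : ∀ n, c • y n ∈ S) : ¬ IsCompact (closure (toWeakSpace ℝ X '' S)) := by
  intro hK
  let t : ℕ → WeakSpace ℝ X := fun n => toWeakSpace ℝ X (c • y n)
  obtain ⟨w, -, hw⟩ := hK.exists_mapClusterPt (f := atTop) (u := t)
    (by rw [Filter.le_principal_iff, Filter.mem_map]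
        exact Eventually.of_forall fun n => subset_closure ⟨_, hS n, rfl⟩)
  obtain ⟨x, rfl⟩ := (toWeakSpace ℝ X).surjective w
  have hlow : ∀ m, c / 2 ≤ ψ m x := by
    intro m
    have hcont : Continuous fun w : WeakSpace ℝ X => ψ m ((toWeakSpace ℝ X).symm w) :=
      WeakBilin.eval_continuous (topDualPairing ℝ X).flip (ψ m)
    have hclosed : IsClosed {w : WeakSpace ℝ X | c / 2 ≤ ψ m ((toWeakSpace ℝ X).symm w)} :=
      isClosed_le continuous_const hcont
    have := hclosed.mem_of_mapClusterPt hw ((eventually_ge_atTop m).mono fun n hn => by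
      simp only [t, Set.mem_ofPred_eq, LinearEquiv.symm_apply_apply, map_smul, smul_eq_mul]
      have := mul_le_mul_of_nonneg_left (h1 m n hn) hc.le
      linarith)
    simpa using this
  -- Mazur: weak and norm closures of a convex set coincide.
  have hmem : x ∈ closure (convexHull ℝ (Set.range fun n => c • y n)) := by
    have hmem' : toWeakSpace ℝ X x ∈
        closure (toWeakSpace ℝ X '' convexHull ℝ (Set.range fun n => c • y n)) :=
      isClosed_closure.mem_of_mapClusterPt hw (Eventually.of_forall fun n =>
        subset_closure ⟨_, subset_convexHull ℝ _ ⟨n, rfl⟩, rfl⟩)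
    rw [← (convex_convexHull ℝ _).toWeakSpace_closure ℝ] at hmem'
    obtain ⟨x', hx', he⟩ := hmem'
    rwa [← (toWeakSpace ℝ X).injective he]
  -- `z` uses only `y n` with `n < N`, so `ψ N z ≤ c / 4`; this radius makes `ψ N x < c / 2`,
  -- contradicting `hlow`.
  obtain ⟨z, hz, hxz⟩ := Metric.mem_closure_iff.1 hmem (c / (4 * C)) (by positivity)
  have hfin : ∃ N, z ∈ convexHull ℝ ((fun n => c • y n) '' Set.Iio N) := by
    have hmono : Monotone fun N => (fun n => c • y n) '' Set.Iio N := fun M N hMN =>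
      Set.image_mono (Set.Iio_subset_Iio hMN)
    have hU : convexHull ℝ (Set.range fun n => c • y n) ⊆
        ⋃ N, convexHull ℝ ((fun n => c • y n) '' Set.Iio N) := by
      refine convexHull_min ?_ (Directed.convex_iUnion
        (directed_of_isDirected_le fun M N hMN => convexHull_mono (hmono hMN))
        fun N => convex_convexHull ℝ _)
      rintro _ ⟨n, rfl⟩
      exact Set.mem_iUnion.2 ⟨n + 1, subset_convexHull ℝ _ ⟨n, n.lt_succ_self, rfl⟩⟩
    exact Set.mem_iUnion.1 (hU hz)
  obtain ⟨N, hzN⟩ := hfin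
  have hup : ψ N z ≤ c / 4 := by
    have hconv : Convex ℝ {z : X | ψ N z ≤ c / 4} :=
      convex_halfSpace_le (ψ N).toLinearMap.isLinear _
    refine convexHull_min ?_ hconv hzN
    rintro _ ⟨n, hn, rfl⟩
    have := mul_le_mul_of_nonneg_left (h2 n N hn) hc.le
    simp only [Set.mem_ofPred_eq, map_smul, smul_eq_mul]
    linarith
  have hd : ψ N x - ψ N z < c / 4 := by
    rw [← map_sub]
    refine (le_abs_self _).trans_lt (((ψ N).le_opNorm _).trans_lt ?_)
    rw [dist_eq_norm] at hxz
    refine (mul_le_mul_of_nonneg_right (hψ N) (norm_nonneg _)).trans_lt ?_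
    refine (mul_lt_mul_of_pos_left hxz hC).trans_eq ?_
    field_simp
  linarith [hlow N]

/-- Bounded operators into reflexive spaces are weakly compact. -/
lemma isWeaklyCompactOperator_of_isReflexiveSpace {E : Type u} [NormedAddCommGroup E]
    [NormedSpace ℝ E] (hX : IsReflexiveSpace X) (T : E →L[ℝ] X) : IsWeaklyCompactOperator T := by
  refine NormedSpace.isCompact_closure_of_isBounded ℝ X _ ?_ ?_
  · rw [Set.preimage_image_eq _ (toWeakSpace ℝ X).injective]
    exact T.lipschitz.isBounded_image Metric.isBounded_closedBall
  · intro F _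
    obtain ⟨x, hx⟩ := hX (WeakDual.toStrongDual F)
    exact ⟨toWeakSpace ℝ X x, by
      refine DFunLike.ext _ _ fun φ => ?_
      exact congrArg (fun G : StrongDual ℝ (StrongDual ℝ X) => G φ) hx⟩

/-- Compact operators are weakly compact. -/
lemma isWeaklyCompactOperator_of_isCompact {E : Type u} [NormedAddCommGroup E]
    [NormedSpace ℝ E] {T : E →L[ℝ] X}
    (hT : IsCompact (closure (T '' Metric.closedBall (0 : E) 1))) : IsWeaklyCompactOperator T := by
  have h := hT.image (toWeakSpaceCLM ℝ X).continuous
  refine h.of_isClosed_subset isClosed_closure (closure_minimal ?_ h.isClosed)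
  rintro _ ⟨x, hx, rfl⟩
  exact ⟨x, subset_closure hx, rfl⟩

end Reflexivity

/-! ### DW-compact operators built from band components. -/

section DWCompact

variable {E : Type u} [NormedAddCommGroup E] [Lattice E] [HasSolidNorm E] [IsOrderedAddMonoid E]
    [NormedSpace ℝ E]

omit [HasSolidNorm E] in
/-- On a disjointly weakly compact set, the components of a positive functional along a disjoint
sequence have uniformly small tails. -/
lemma IsDisjointlyWeaklyCompact.exists_tail_le {A : Set E} (hA : IsDisjointlyWeaklyCompact A)
    {f : StrongDual ℝ E} {z : ℕ → E} (hz : ∀ n, 0 ≤ z n) (hd : ∀ m n, m ≠ n → z m ⊓ z n = 0)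
    {φ : ℕ → StrongDual ℝ E}
    (hφ : ∀ n x, 0 ≤ x → Tendsto (fun k : ℕ => f (x ⊓ k • z n)) atTop (𝓝 (φ n x)))
    {ε : ℝ} (hε : 0 < ε) :
    ∃ N, ∀ a ∈ A, ∀ M, ∑ n ∈ Finset.Ico N M, φ n |a| ≤ ε := by
  by_contra! hcon
  -- Truncating at a finite `k` keeps the strict inequality and replaces the components by values of
  -- `f` at actual elements of `E`.
  have hk : ∀ N, ∃ a ∈ A, ∃ M k : ℕ, ε < f (∑ n ∈ Finset.Ico N M, |a| ⊓ k • z n) := by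
    intro N
    obtain ⟨a, ha, M, hM⟩ := hcon N
    have hlim := tendsto_finsetSum (Finset.Ico N M) fun n _ => hφ n |a| (abs_nonneg a)
    obtain ⟨k, hk⟩ := (hlim.eventually (lt_mem_nhds hM)).exists
    exact ⟨a, ha, M, k, by rwa [map_sum]⟩
  choose a ha M k hlt using hk
  have hNM : ∀ N, N ≤ M N := fun N => by
    by_contra hlt'
    have := hlt N
    rw [Finset.Ico_eq_empty (fun h => hlt' h.le), Finset.sum_empty, map_zero] at this
    exact hε.not_gt this
  -- Iterating `M` makes the index blocks consecutive, so the block sums `u j` are disjoint; each is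
  -- below `|a (s j)|`, hence in the solid hull.
  let s : ℕ → ℕ := fun j => M^[j] 0
  have hs : ∀ j, s (j + 1) = M (s j) := fun j => Function.iterate_succ_apply' M j 0
  have hsm : Monotone s := monotone_nat_of_le_succ fun j => (hs j).symm ▸ hNM (s j)
  let u : ℕ → E := fun j => ∑ n ∈ Finset.Ico (s j) (s (j + 1)), |a (s j)| ⊓ k (s j) • z n
  have hterm : ∀ j n, 0 ≤ |a (s j)| ⊓ k (s j) • z n := fun j n =>
    le_inf (abs_nonneg _) (nsmul_nonneg (hz n) _)
  have hu0 : ∀ j, 0 ≤ u j := fun j => Finset.sum_nonneg fun n _ => hterm j n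
  have hdisj : ∀ i j m n, m ≠ n →
      (|a (s i)| ⊓ k (s i) • z m) ⊓ (|a (s j)| ⊓ k (s j) • z n) = 0 := by
    intro i j m n hmn
    refine inf_eq_zero_of_le (hterm i m) (hterm j n) inf_le_right inf_le_right ?_
    apply nsmul_inf_eq_zero (hz m) (nsmul_nonneg (hz n) _)
    rw [inf_comm]
    exact nsmul_inf_eq_zero (hz n) (hz m) (hd n m hmn.symm) _
  have hud' : ∀ i j, i < j → u i ⊓ u j = 0 := by
    intro i j hij
    refine sum_inf_eq_zero (fun m _ => hterm i m) (hu0 j) fun m hm => ?_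
    rw [inf_comm]
    refine sum_inf_eq_zero (fun n _ => hterm j n) (hterm i m) fun n hn => hdisj _ _ _ _ ?_
    have h1 := (Finset.mem_Ico.1 hm).2
    have h2 := (Finset.mem_Ico.1 hn).1
    have h3 : s (i + 1) ≤ s j := hsm hij
    omega
  have hud : IsDisjointSeq u := fun i j hij => by
    rw [abs_of_nonneg (hu0 i), abs_of_nonneg (hu0 j)]
    rcases lt_or_gt_of_ne hij with h | h
    · exact hud' i j h
    · rw [inf_comm]; exact hud' j i h
  have husol : ∀ j, u j ∈ LatticeOrderedAddCommGroup.solidClosure A := fun j => by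
    refine ⟨a (s j), ha _, ?_⟩
    rw [abs_of_nonneg (hu0 j)]
    exact sum_le_of_disjoint (hterm j) (abs_nonneg _) (fun n => inf_le_left)
      fun m n hmn => hdisj j j m n hmn
  refine absurd (ge_of_tendsto' (hA.2 u hud husol f) fun j => ?_) (not_le.2 hε)
  have := (hlt (s j)).le
  rwa [← hs j] at this

variable {X : Type v} [NormedAddCommGroup X] [NormedSpace ℝ X] [CompleteSpace X]

/-- The operator `x ↦ ∑ φ n x • y n` determined by the components of a positive functional along a
disjoint sequence `z` is DW-compact and sends `z n` to `f (z n) • y n`. -/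
lemma exists_isDWCompact_apply_eq {f : StrongDual ℝ E} (hf : IsPositiveFunctional f) {z : ℕ → E}
    (hz : ∀ n, 0 ≤ z n) (hd : ∀ m n, m ≠ n → z m ⊓ z n = 0) {y : ℕ → X} {R : ℝ} (hR : 0 < R)
    (hy : ∀ n, ‖y n‖ ≤ R) :
    ∃ T : E →L[ℝ] X, IsDWCompact T ∧ ∀ n, T (z n) = f (z n) • y n := by
  obtain ⟨φ, hφ0, hφ, hφz, hφd, hφs⟩ := exists_components hf hz hd
  have hterm : ∀ n x, ‖φ n x • y n‖ ≤ φ n |x| * R := fun n x => by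
    rw [norm_smul, Real.norm_eq_abs]
    exact mul_le_mul ((hφ0 n).abs_apply_le x) (hy n) (norm_nonneg _) (hφ0 n _ (abs_nonneg x))
  have hfx : ∀ x, f |x| ≤ ‖f‖ * ‖x‖ := fun x => by
    have := (le_abs_self _).trans (f.le_opNorm |x|)
    rwa [norm_abs_eq_norm] at this
  have hsum_le : ∀ (s : Finset ℕ) x, ∑ n ∈ s, ‖φ n x • y n‖ ≤ ‖f‖ * R * ‖x‖ := fun s x => by
    refine (Finset.sum_le_sum fun n _ => hterm n x).trans ?_
    rw [← Finset.sum_mul, mul_right_comm]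
    exact mul_le_mul_of_nonneg_right ((hφs s _ (abs_nonneg x)).trans (hfx x)) hR.le
  have hsn : ∀ x, Summable fun n => ‖φ n x • y n‖ := fun x =>
    summable_of_sum_le (fun n => norm_nonneg _) fun s => hsum_le s x
  have hs : ∀ x, Summable fun n => φ n x • y n := fun x => (hsn x).of_norm
  let T : E →L[ℝ] X := LinearMap.mkContinuous
    { toFun := fun x => ∑' n, φ n x • y n
      map_add' := fun a b => by
        simp only [map_add, add_smul]
        exact (hs a).tsum_add (hs b)
      map_smul' := fun c a => by
        simp only [map_smul, smul_assoc, RingHom.id_apply]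
        exact (hs a).tsum_const_smul c } (‖f‖ * R) (fun x =>
      (norm_tsum_le_tsum_norm (hsn x)).trans
        ((hsn x).tsum_le_of_sum_le fun s => hsum_le s x))
  have hT : ∀ x, T x = ∑' n, φ n x • y n := fun x => rfl
  refine ⟨T, fun A hA => ?_, fun n => ?_⟩
  · refine (TotallyBounded.closure ?_).isCompact_of_isClosed isClosed_closure
    refine Metric.totallyBounded_iff.2 fun ε hε => ?_
    obtain ⟨N, hN⟩ := hA.exists_tail_le hz hd hφ (show 0 < ε / 2 / R / 2 by positivity)
    -- `G ∘ L` is the `N`-th partial sum of `T`. It factors through a finite-dimensional space, so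
    -- `G (L A)` is totally bounded, and it is within `ε / 2` of `T` on `A`.
    let L : E →L[ℝ] (Fin N → ℝ) := ContinuousLinearMap.pi fun i => φ i
    let G : (Fin N → ℝ) →L[ℝ] X := ∑ i : Fin N, (ContinuousLinearMap.proj i).smulRight (y i)
    have hGL : ∀ x, G (L x) = ∑ n ∈ Finset.range N, φ n x • y n := fun x => by
      rw [Finset.sum_range]
      simp [G, L, sum_apply]
    have htb : TotallyBounded (G '' (L '' A)) :=
      ((Bornology.IsBounded.isCompact_closure (L.lipschitz.isBounded_image hA.1)).totallyBounded.subset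
        subset_closure).image G.uniformContinuous
    obtain ⟨t, ht, htA⟩ := Metric.totallyBounded_iff.1 htb (ε / 2) (by positivity)
    refine ⟨t, ht, ?_⟩
    rintro _ ⟨a, ha, rfl⟩
    obtain ⟨w, hwt, hw⟩ := Set.mem_iUnion₂.1 (htA ⟨L a, ⟨a, ha, rfl⟩, rfl⟩)
    refine Set.mem_iUnion₂.2 ⟨w, hwt, ?_⟩
    have hclose : ‖T a - G (L a)‖ ≤ ε / 2 := by
      have hlim : Tendsto (fun M => ‖∑ n ∈ Finset.range M, φ n a • y n - G (L a)‖) atTop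
          (𝓝 ‖T a - G (L a)‖) := ((hs a).hasSum.tendsto_sum_nat.sub_const _).norm
      refine le_of_tendsto hlim ((eventually_ge_atTop N).mono fun M hM => ?_)
      rw [hGL, ← Finset.sum_Ico_eq_sub _ hM]
      refine (norm_sum_le_of_le _ fun n _ => hterm n a).trans ?_
      rw [← Finset.sum_mul]
      refine (mul_le_mul_of_nonneg_right (hN a ha M) hR.le).trans ?_
      have : ε / 2 / R / 2 * R = ε / 4 := by field_simp; norm_num
      linarith
    rw [Metric.mem_ball] at hw ⊢
    calc dist (T a) w ≤ dist (T a) (G (L a)) + dist (G (L a)) w := dist_triangle _ _ _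
      _ < ε / 2 + ε / 2 := add_lt_add_of_le_of_lt (by rwa [dist_eq_norm]) hw
      _ = ε := add_halves ε
  · rw [hT, tsum_eq_single n fun m hm => by rw [hφd m n hm, zero_smul], hφz]

end DWCompact
end BanachLattice

/-! ### The equivalence. -/

open BanachLattice in
theorem mainTheorem10
    (E : Type u) [NormedAddCommGroup E] [Lattice E] [HasSolidNorm E] [IsOrderedAddMonoid E]
    [NormedSpace ℝ E] [IsOrderedModule ℝ E] [CompleteSpace E]
    (X : Type v) [NormedAddCommGroup X] [NormedSpace ℝ X] [CompleteSpace X] :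
    (∀ T : E →L[ℝ] X, BanachLattice.IsDWCompact T → BanachLattice.IsWeaklyCompactOperator T) ↔
      (BanachLattice.DualHasOrderContinuousNorm E ∨ BanachLattice.IsReflexiveSpace X) := by
  constructor
  · intro h
    by_contra! hcon
    obtain ⟨hE, hX⟩ := hcon
    have hns := mt dualHasOrderContinuousNorm_of_forall_tendsto hE
    push Not at hns
    obtain ⟨f, hf, z, hz, hz1, hd, hlim⟩ := hns
    obtain ⟨ε, hε, hfreq⟩ : ∃ ε > 0, ∃ᶠ n in atTop, ε ≤ f (z n) := by
      by_contra! hno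
      refine hlim (Metric.tendsto_nhds.2 fun ε hε => ?_)
      filter_upwards [hno ε hε] with n hn
      rwa [Real.dist_eq, sub_zero, abs_of_nonneg (hf _ (hz n))]
    obtain ⟨σ, hσ, hσε⟩ := Filter.extraction_of_frequently_atTop hfreq
    obtain ⟨y, ψ, C, hC, ⟨R, hR⟩, hψ, h1, h2⟩ := exists_triangular_seq hX
    obtain ⟨T, hT, hTz⟩ := exists_isDWCompact_apply_eq hf (z := z ∘ σ) (fun n => hz _)
      (fun m n hmn => hd _ _ fun e => hmn (hσ.injective e)) (y := y) (R := |R| + 1)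
      (by positivity) (fun n => by linarith [hR n, le_abs_self R])
    refine not_isCompact_closure_of_triangular hC hψ h1 h2 hε (fun n => ?_) (h T hT)
    have hpos : 0 < f (z (σ n)) := hε.trans_le (hσε n)
    -- The factor is at most 1, so the point stays in the unit ball, and it normalises the image to
    -- `ε • y n`.
    refine ⟨(ε / f (z (σ n))) • z (σ n), ?_, ?_⟩
    · rw [mem_closedBall_zero_iff, norm_smul, Real.norm_of_nonneg (by positivity)]
      exact mul_le_one₀ ((div_le_one hpos).2 (hσε n)) (norm_nonneg _) (hz1 _)
    · have := hTz n
      simp only [Function.comp] at this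
      rw [map_smul, this, smul_smul, div_mul_cancel₀ _ hpos.ne']
  · rintro (hE | hX) T hT
    · exact isWeaklyCompactOperator_of_isCompact (hT _ (isDisjointlyWeaklyCompact_closedBall hE))
    · exact isWeaklyCompactOperator_of_isReflexiveSpace hX T
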